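/- For an odd integer $t\ge 3$, a $t$-Schur overpartition of an integer $N\ge 0$ is a partition of $N$ all of whose parts are congruent modulo $2t$ to an element of $\{1,3,5,\dots,2t-1\}\setminus\{t\}$, in which the first occurrence of each distinct part may be overlined. Let $\overline{S}_t(N)$ denote the number of $t$-Schur overpartitions of $N$ and, for $r\ge 1$, let $\overline{S}_t^{\,r}(N)$ denote the number of $r$-tuples of $t$-Schur overpartitions whose sizes add up to $N$; equivalently, $$\sum_{N\ge 0}\overline{S}_t^{\,r}(N)q^N=\prod_{k\ge 1}\frac{(1+q^{2k-1})^r(1-q^{t(2k-1)})^r}{(1+q^{t(2k-1)})^r(1-q^{2k-1})^r},\qquad \overline{S}_t=\overline{S}_t^{\,1}.$$ **Theorem.** Let $p$ be a prime with $p\equiv 5\pmod 6$, let $\alpha, n, m\ge 0$ be integers, and let $i$ be an integer with $1\le i\le p-1$. Then $$\overline{S}_3\left(24p^{2\alpha+2}n+(24i+7p)p^{2\alpha+1}\right)\equiv 0\pmod{32}$$ and $$\overline{S}_3^{\,16m+1}\left(24p^{2\alpha+2}n+(24i+19p)p^{2\alpha+1}\right)\equiv 0\pmod{32}.$$ -/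

import Mathlib

/-- The admissible residues modulo `2t` of the parts of a `t`-Schur overpartition:
`{1, 3, 5, …, 2t - 1} \ {t}`. -/
def schurResidues (t : ℕ) : Finset ℕ :=
  {i ∈ Finset.range (2 * t) | Odd i ∧ i ≠ t}

/-- A `t`-Schur overpartition of `n`: a partition of `n` all of whose parts are congruent
modulo `2t` to an element of `schurResidues t`, in which, for each part size that occurs,
the first occurrence of that part may be overlined. The overlining is recorded by the set
of those part sizes whose first occurrence is overlined. -/
@[ext]
structure SchurOverpartition (t n : ℕ) where
  /-- the underlying partition -/
  partition : n.Partition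
  /-- every part has an admissible residue -/
  residue_mem : ∀ i ∈ partition.parts, i % (2 * t) ∈ schurResidues t
  /-- the part sizes whose first occurrence is overlined -/
  overlined : Finset ℕ
  /-- only parts that occur can be overlined -/
  overlined_subset : overlined ⊆ partition.parts.toFinset

/-- There are finitely many `t`-Schur overpartitions of `n`. -/
instance SchurOverpartition.instFinite (t n : ℕ) : Finite (SchurOverpartition t n) := by
  let f : SchurOverpartition t n →
      Σ p : n.Partition, {s : Finset ℕ // s ∈ p.parts.toFinset.powerset} :=
    fun P => ⟨P.partition, P.overlined, Finset.mem_powerset.mpr P.overlined_subset⟩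
  refine Finite.of_injective f ?_
  rintro ⟨p, hp, s, hs⟩ ⟨p', hp', s', hs'⟩ h
  simp only [f, Sigma.mk.injEq] at h
  obtain ⟨rfl, h⟩ := h
  simpa using h

/-- The number of `t`-Schur overpartitions of `n`. -/
noncomputable def schurOverpartitionCount (t n : ℕ) : ℕ :=
  Nat.card (SchurOverpartition t n)

/-- An `r`-tuple of `t`-Schur overpartitions of total size `n`: sizes `s 0, …, s (r - 1)` with
sum `n`, together with a `t`-Schur overpartition of `s j` for each index `j`. -/
abbrev SchurOverpartitionTuple (t r n : ℕ) : Type :=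
  Σ s : {s : Fin r → ℕ // s ∈ Finset.finAntidiagonal r n},
    ∀ j : Fin r, SchurOverpartition t (s.1 j)

/-- The number of `r`-tuples of `t`-Schur overpartitions of total size `n`. -/
noncomputable def schurOverpartitionTupleCount (t r n : ℕ) : ℕ :=
  Nat.card (SchurOverpartitionTuple t r n)

/-
Gauss's product formulas turn the generating function `F` of the `3`-Schur overpartitions into a
quotient of theta series, `F(q) φ(-q²) φ(-q⁶) = φ(q) φ(-q³)`. Dissecting this identity
successively modulo `2`, `2` and `3`, by elementary substitutions in the quadratic forms behind
products of two theta series, shows that the terms `q ^ (12 n + 7)` of `F` carry a factor `8`. The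
cofactor is congruent modulo `4` to `ψ(q²) (f(q⁸) - 2 q f(q³²))`, where `f` is Euler's product. By
the pentagonal number theorem both products are series over pairs of integers whose exponents `n`
satisfy `12 n + 7 = 3 x² + y²`, so that the coefficient of `q ^ N` in `F` vanishes modulo `32`
whenever `N ≡ 7 [MOD 12]` is not of this form. Multiplication by `F ^ (16 m)` changes nothing,
because `F ≡ 1` modulo `2` and hence `F ^ 16 ≡ 1` modulo `32`. Finally, a prime `p ≡ 5 [MOD 6]`,
for which `-3` is not a square, divides every nonzero value of `3 x² + y²` to an even power.
-/

open PowerSeries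

namespace ThetaSeries

/-- `f(q) ↦ f(q ^ k)` -/
local notation "V[" k "]" => expand k (NeZero.ne k)

section Dissection

variable {R : Type*} [CommRing R] {k r : ℕ}

/-- The `r`-th component of the `k`-dissection of a power series: the series `∑ a (k * n + r) q ^ n`
attached to `∑ a n q ^ n`. -/
noncomputable def dissect (k r : ℕ) : R⟦X⟧ →ₗ[R] R⟦X⟧ where
  toFun f := PowerSeries.mk fun n => coeff (k * n + r) f
  map_add' f g := by ext n; simp
  map_smul' c f := by ext n; simp

@[simp]
theorem coeff_dissect (k r n : ℕ) (f : R⟦X⟧) :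
    coeff n (dissect k r f) = coeff (k * n + r) f := by
  simp [dissect]

theorem dissect_dissect (k r l s : ℕ) (f : R⟦X⟧) :
    dissect k r (dissect l s f) = dissect (l * k) (l * r + s) f := by
  ext n
  simp only [coeff_dissect, mul_add, mul_assoc, add_assoc]

theorem ext_dissect (hk : k ≠ 0) {f g : R⟦X⟧} (h : ∀ r < k, dissect k r f = dissect k r g) :
    f = g := by
  ext n
  have := congrArg (coeff (n / k)) (h (n % k) (Nat.mod_lt n (Nat.pos_of_ne_zero hk)))
  simpa only [coeff_dissect, Nat.div_add_mod] using this

theorem dissect_X_pow_mul_expand (hk : k ≠ 0) (hr : r < k) {s : ℕ} (hs : s < k) (f : R⟦X⟧) :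
    dissect k r (X ^ s * expand k hk f) = if s = r then f else 0 := by
  ext n
  rw [coeff_dissect, coeff_X_pow_mul', coeff_expand]
  obtain rfl | hsr := eq_or_ne s r
  · simp [Nat.pos_of_ne_zero hk]
  · suffices s ≤ k * n + r → ¬ k ∣ k * n + r - s by simpa [hsr] using fun h h' => absurd h' (this h)
    rintro hle ⟨m, hm⟩
    have := congrArg (· % k) (show k * n + r = k * m + s by omega)
    exact hsr (by simpa [Nat.mod_eq_of_lt hr, Nat.mod_eq_of_lt hs, eq_comm] using this)

theorem eq_sum_X_pow_mul_expand_dissect (hk : k ≠ 0) (f : R⟦X⟧) :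
    f = ∑ s ∈ Finset.range k, X ^ s * expand k hk (dissect k s f) := by
  refine ext_dissect hk fun r hr => ?_
  rw [map_sum, Finset.sum_congr rfl fun s hs =>
    dissect_X_pow_mul_expand hk hr (Finset.mem_range.1 hs) _]
  simp [hr]

theorem dissect_expand_mul (hk : k ≠ 0) (hr : r < k) (f g : R⟦X⟧) :
    dissect k r (expand k hk f * g) = f * dissect k r g := by
  conv_lhs => rw [eq_sum_X_pow_mul_expand_dissect hk g, Finset.mul_sum, map_sum]
  rw [Finset.sum_congr rfl fun s hs => by
    rw [mul_left_comm, ← map_mul, dissect_X_pow_mul_expand hk hr (Finset.mem_range.1 hs)]]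
  simp [hr]

theorem dissect_two_zero_add (f g : R⟦X⟧) :
    dissect 2 0 (expand 2 two_ne_zero f + X * expand 2 two_ne_zero g) = f := by
  have hf := dissect_X_pow_mul_expand two_ne_zero two_pos two_pos f
  have hg := dissect_X_pow_mul_expand two_ne_zero two_pos one_lt_two g
  simpa [pow_zero] using congrArg₂ (· + ·) hf hg

theorem dissect_two_one_add (f g : R⟦X⟧) :
    dissect 2 1 (expand 2 two_ne_zero f + X * expand 2 two_ne_zero g) = g := by
  have hf := dissect_X_pow_mul_expand two_ne_zero one_lt_two two_pos f
  have hg := dissect_X_pow_mul_expand two_ne_zero one_lt_two one_lt_two g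
  simpa [pow_zero] using congrArg₂ (· + ·) hf hg

theorem dissect_three_one_add (f g h : R⟦X⟧) :
    dissect 3 1 (expand 3 three_ne_zero f + X * expand 3 three_ne_zero g +
      X ^ 2 * expand 3 three_ne_zero h) = g := by
  have hf := dissect_X_pow_mul_expand three_ne_zero (r := 1) (by decide) (s := 0) (by decide) f
  have hg := dissect_X_pow_mul_expand three_ne_zero (r := 1) (by decide) (s := 1) (by decide) g
  have hh := dissect_X_pow_mul_expand three_ne_zero (r := 1) (by decide) (s := 2) (by decide) h
  rw [pow_zero, one_mul] at hf
  rw [pow_one] at hg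
  simp [hf, hg, hh]

theorem expand_two_injective : Function.Injective (expand (R := R) 2 two_ne_zero) := fun f g h => by
  rw [← dissect_two_zero_add f 0, h, dissect_two_zero_add]

theorem dissect_natCast_mul (k r c : ℕ) (f : R⟦X⟧) :
    dissect k r ((c : R⟦X⟧) * f) = c * dissect k r f := by
  rw [← nsmul_eq_mul, map_nsmul, nsmul_eq_mul]

theorem coeff_evalNegHom (n : ℕ) (f : R⟦X⟧) : coeff n (evalNegHom f) = (-1) ^ n * coeff n f :=
  coeff_rescale f (-1) n

theorem evalNegHom_evalNegHom (f : R⟦X⟧) : evalNegHom (evalNegHom f) = f := by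
  ext n
  rw [coeff_evalNegHom, coeff_evalNegHom, ← mul_assoc, ← mul_pow]
  simp

theorem evalNegHom_expand_of_even (hk : k ≠ 0) (h : Even k) (f : R⟦X⟧) :
    evalNegHom (expand k hk f) = expand k hk f := by
  ext n
  rw [coeff_evalNegHom, coeff_expand]
  split_ifs with hn
  · rw [(h.trans_dvd hn).neg_one_pow, one_mul]
  · rw [mul_zero]

theorem evalNegHom_expand_of_odd (hk : k ≠ 0) (h : Odd k) (f : R⟦X⟧) :
    evalNegHom (expand k hk f) = expand k hk (evalNegHom f) := by
  ext n
  rw [coeff_evalNegHom, coeff_expand, coeff_expand]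
  split_ifs with hn
  · obtain ⟨m, rfl⟩ := hn
    rw [Nat.mul_div_cancel_left _ (Nat.pos_of_ne_zero hk), coeff_evalNegHom, pow_mul, h.neg_one_pow]
  · rw [mul_zero]

theorem constantCoeff_evalNegHom (f : R⟦X⟧) : constantCoeff (evalNegHom f) = constantCoeff f := by
  simpa using coeff_evalNegHom 0 f

theorem eq_expand_two_add (f : R⟦X⟧) : f =
    expand 2 two_ne_zero (dissect 2 0 f) + X * expand 2 two_ne_zero (dissect 2 1 f) := by
  simpa [Finset.sum_range_succ] using eq_sum_X_pow_mul_expand_dissect two_ne_zero f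

theorem add_evalNegHom (f : R⟦X⟧) :
    f + evalNegHom f = 2 * expand 2 two_ne_zero (dissect 2 0 f) := by
  nth_rw 1 2 [eq_expand_two_add f]
  simp only [map_add, map_mul, evalNegHom_X, evalNegHom_expand_of_even two_ne_zero even_two]
  ring

end Dissection

section Series

variable {ι κ R : Type*} [CommRing R] {e : ι → ℤ} {e' : κ → ℤ} {w : ι → R} {w' : κ → R}

/-- The formal series `∑ i, w i * X ^ e i` with integer exponents; terms with a negative exponent
are discarded, and so are exponents that are taken by infinitely many nonzero terms. -/
noncomputable def series (e : ι → ℤ) (w : ι → R) : R⟦X⟧ :=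
  PowerSeries.mk fun n => ∑ᶠ i ∈ e ⁻¹' {(n : ℤ)}, w i

theorem coeff_series (e : ι → ℤ) (w : ι → R) (n : ℕ) :
    coeff n (series e w) = ∑ᶠ i ∈ e ⁻¹' {(n : ℤ)}, w i :=
  coeff_mk n _

theorem coeff_series_eq_zero (w : ι → R) {n : ℕ} (h : ∀ i, e i ≠ n) :
    coeff n (series e w) = 0 := by
  rw [coeff_series]
  exact finsum_mem_eq_zero_of_forall_eq_zero fun i hi => absurd hi (h i)

/-- The condition under which `∑ i, X ^ e i` is a power series: no exponent is negative and each is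
taken finitely often. -/
structure IsExponent (e : ι → ℤ) : Prop where
  nonneg : ∀ i, 0 ≤ e i
  finite : ∀ n, (e ⁻¹' {n}).Finite

theorem coeff_series_eq_sum (he : IsExponent e) (w : ι → R) (n : ℕ) :
    coeff n (series e w) = ∑ i ∈ (he.finite n).toFinset, w i := by
  rw [coeff_series, finsum_mem_eq_finite_toFinset_sum]

theorem IsExponent.const_mul (he : IsExponent e) {k : ℤ} (hk : 0 < k) :
    IsExponent fun i => k * e i where
  nonneg i := mul_nonneg hk.le (he.nonneg i)
  finite n := (he.finite (n / k)).subset fun i hi => by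
    rw [Set.mem_preimage, Set.mem_singleton_iff] at hi ⊢
    rw [← hi, Int.mul_ediv_cancel_left _ hk.ne']

theorem preimage_add_eq_biUnion [DecidableEq ι] [DecidableEq κ] (he : IsExponent e)
    (he' : IsExponent e') (n : ℕ) :
    (fun x : ι × κ => e x.1 + e' x.2) ⁻¹' {(n : ℤ)} =
      (Finset.HasAntidiagonal.antidiagonal n).biUnion fun p =>
        (he.finite p.1).toFinset ×ˢ (he'.finite p.2).toFinset := by
  ext ⟨i, j⟩
  lift e to ι → ℕ using he.nonneg
  lift e' to κ → ℕ using he'.nonneg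
  simp only [Set.mem_preimage, Set.mem_singleton_iff, Finset.coe_biUnion, SetLike.mem_coe,
    Finset.HasAntidiagonal.mem_antidiagonal, Finset.coe_product, Set.Finite.coe_toFinset,
    Set.mem_iUnion, Set.mem_prod, exists_and_left, exists_prop, Prod.exists]
  norm_cast
  simp

theorem IsExponent.add (he : IsExponent e) (he' : IsExponent e') :
    IsExponent fun x : ι × κ => e x.1 + e' x.2 where
  nonneg x := add_nonneg (he.nonneg _) (he'.nonneg _)
  finite n := by
    classical
    obtain hn | hn := lt_or_ge n 0
    · refine Set.finite_empty.subset fun x hx => ?_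
      have := add_nonneg (he.nonneg x.1) (he'.nonneg x.2)
      exact absurd hx (by simp only [Set.mem_preimage, Set.mem_singleton_iff]; omega)
    · lift n to ℕ using hn
      rw [preimage_add_eq_biUnion he he']
      exact Finset.finite_toSet _

theorem series_mul_series (he : IsExponent e) (he' : IsExponent e') (w : ι → R) (w' : κ → R) :
    series e w * series e' w' =
      series (fun x : ι × κ => e x.1 + e' x.2) fun x => w x.1 * w' x.2 := by
  classical
  ext n
  rw [coeff_mul, coeff_series, preimage_add_eq_biUnion he he', finsum_mem_coe_finset,
    Finset.sum_biUnion]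
  · refine Finset.sum_congr rfl fun p _ => ?_
    rw [coeff_series_eq_sum he, coeff_series_eq_sum he', Finset.sum_product, Finset.sum_mul_sum]
  · rintro ⟨a, b⟩ - ⟨c, d⟩ - hne
    rw [Function.onFun, Finset.disjoint_left]
    rintro ⟨i, j⟩ h h'
    simp only [Finset.mem_product, Set.Finite.mem_toFinset, Set.mem_preimage,
      Set.mem_singleton_iff] at h h'
    exact hne (Prod.ext (by exact_mod_cast h.1.symm.trans h'.1)
      (by exact_mod_cast h.2.symm.trans h'.2))

theorem expand_series {k : ℕ} (hk : k ≠ 0) (e : ι → ℤ) (w : ι → R) :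
    expand k hk (series e w) = series (fun i => k * e i) w := by
  ext n
  rw [coeff_expand]
  split_ifs with h
  · obtain ⟨m, rfl⟩ := h
    rw [Nat.mul_div_cancel_left _ (Nat.pos_of_ne_zero hk), coeff_series, coeff_series]
    congr! 3 with i
    simp [hk]
  · refine (coeff_series_eq_zero _ fun i hi => h ?_).symm
    exact Int.natCast_dvd_natCast.1 ⟨_, hi.symm⟩

theorem evalNegHom_series (e : ι → ℤ) (w : ι → R) :
    evalNegHom (series e w) = series e fun i => ((e i).negOnePow : ℤ) * w i := by
  ext n
  rw [coeff_evalNegHom, coeff_series, coeff_series]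
  have hw : ∀ i ∈ e ⁻¹' {(n : ℤ)}, ((e i).negOnePow : ℤ) * w i = (-1) ^ n * w i := fun i hi => by
    rw [show e i = n from hi, Int.coe_negOnePow_natCast]
    push_cast
    rfl
  rw [finsum_mem_congr rfl hw]
  obtain h | h := neg_one_pow_eq_or R n <;> simp [h, finsum_neg_distrib]

theorem dissect_series {k r : ℕ} (hk : k ≠ 0) (g : κ → ι) (hg : Function.Injective g)
    (he : ∀ j, e (g j) = k * e' j + r) (hw : ∀ j, w (g j) = w' j)
    (hsurj : ∀ i, e i ≡ r [ZMOD k] → ∃ j, g j = i) :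
    dissect k r (series e w) = series e' w' := by
  ext n
  rw [coeff_dissect, coeff_series, coeff_series]
  refine (finsum_mem_eq_of_bijOn g ⟨fun j hj => ?_, hg.injOn, fun i hi => ?_⟩
    fun j _ => (hw j).symm).symm
  · rw [Set.mem_preimage, Set.mem_singleton_iff] at hj ⊢
    simp [he, hj]
  · rw [Set.mem_preimage, Set.mem_singleton_iff] at hi
    obtain ⟨j, rfl⟩ := hsurj i (by simp [hi, Int.ModEq])
    refine ⟨j, ?_, rfl⟩
    simpa [he, hk] using hi

theorem dissect_series_of_neg [InvolutiveNeg ι] (hfin : IsExponent e) (heven : ∀ i, e (-i) = e i)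
    {k r : ℕ} (hk : k ≠ 0) (g : κ → ι) (hg : Function.Injective g)
    (he : ∀ j, e (g j) = k * e' j + r) (hdisj : ∀ j j', g j ≠ -g j')
    (hsurj : ∀ i, e i ≡ r [ZMOD k] → ∃ j, g j = i ∨ g j = -i) :
    dissect k r (series e fun _ => (1 : R)) = 2 * series e' fun _ => 1 := by
  ext n
  set F := e' ⁻¹' {(n : ℤ)}
  have hF : e ⁻¹' {((k * n + r : ℕ) : ℤ)} = g '' F ∪ (fun j => -g j) '' F := by
    refine Set.Subset.antisymm (fun i hi => ?_) (Set.union_subset ?_ ?_)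
    · rw [Set.mem_preimage, Set.mem_singleton_iff] at hi
      obtain ⟨j, hj⟩ := hsurj i (by simp [hi, Int.ModEq])
      have hj' : e (g j) = e i := by rcases hj with hj | hj <;> simp [hj, heven]
      have hjF : j ∈ F := by simpa [F, hk, hi, he] using hj'
      exact hj.imp (fun h => ⟨j, hjF, h⟩) fun h => ⟨j, hjF, by simp [h]⟩
    all_goals
      rintro _ ⟨j, hj, rfl⟩
      simp_all [F]
  have hdisjoint : Disjoint (g '' F) ((fun j => -g j) '' F) := by
    rw [Set.disjoint_left]
    rintro _ ⟨j, -, rfl⟩ ⟨j', -, h⟩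
    exact hdisj j j' h.symm
  have hg' : Function.Injective fun j => -g j := neg_injective.comp hg
  have hfinF := hfin.finite ((k * n + r : ℕ) : ℤ)
  rw [hF, Set.finite_union] at hfinF
  rw [coeff_dissect, coeff_series, hF, finsum_mem_union hdisjoint hfinF.1 hfinF.2,
    finsum_mem_image hg.injOn, finsum_mem_image hg'.injOn, two_mul, map_add, coeff_series]

end Series

section Theta

theorem sq_le_quadratic {a b : ℤ} (h : |b| < a) (n : ℤ) : n ^ 2 ≤ a * n ^ 2 + b * n := by
  have hn : |n| ≤ n ^ 2 := by
    rw [← sq_abs]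
    exact Int.le_self_sq _
  have hbn : -(|b| * |n|) ≤ b * n := by
    rw [← abs_mul]
    exact neg_abs_le _
  nlinarith [abs_nonneg b, sq_nonneg n]

theorem isExponent_quadratic {a b : ℤ} (h : |b| < a) :
    IsExponent fun n : ℤ => a * n ^ 2 + b * n where
  nonneg n := (sq_nonneg n).trans (sq_le_quadratic h n)
  finite m := (Set.finite_Icc (-m) m).subset fun n hn => by
    rw [Set.mem_preimage, Set.mem_singleton_iff] at hn
    have := sq_le_quadratic h n
    exact abs_le.1 <| (Int.le_self_sq _).trans <| by rw [sq_abs, ← hn]; exact this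

theorem isExponent_sq : IsExponent fun n : ℤ => n ^ 2 := by
  simpa using isExponent_quadratic (a := 1) (b := 0) (by simp)

theorem isExponent_two_mul_sq_add : IsExponent fun n : ℤ => 2 * n ^ 2 + n := by
  simpa using isExponent_quadratic (a := 2) (b := 1) (by simp)

theorem isExponent_pentagonal : IsExponent fun n : ℤ => (pentagonal n : ℤ) where
  nonneg _ := Int.natCast_nonneg _
  finite m := (Set.finite_singleton m).preimage (Nat.cast_injective.comp pentagonal_injective).injOn

/-- Ramanujan's theta function `φ(q) = ∑ q ^ n ^ 2`, the sum being over all integers `n`. -/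
noncomputable def phi : ℤ⟦X⟧ := series (fun n : ℤ => n ^ 2) fun _ => 1

/-- Ramanujan's theta function `ψ(q) = ∑ q ^ (n * (n + 1) / 2)` over the natural numbers, written as
`∑ q ^ (2 * n ^ 2 + n)` over the integers. -/
noncomputable def psi : ℤ⟦X⟧ := series (fun n : ℤ => 2 * n ^ 2 + n) fun _ => 1

/-- The theta function `∑ q ^ (3 * n ^ 2 + 2 * n)`, over all integers `n`, that occurs in the
`3`-dissection of `phi`. -/
noncomputable def omega : ℤ⟦X⟧ := series (fun n : ℤ => 3 * n ^ 2 + 2 * n) fun _ => 1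

/-- The Euler product `∏ (1 - q ^ n)`. -/
noncomputable abbrev euler : ℤ⟦X⟧ := pentagonalSeries ℤ

theorem euler_eq_series :
    euler = series (fun n : ℤ => (pentagonal n : ℤ)) fun n => (n.negOnePow : ℤ) := by
  ext n
  by_cases h : n ∈ Set.range pentagonal
  · obtain ⟨k, rfl⟩ := h
    have : (fun n : ℤ => (pentagonal n : ℤ)) ⁻¹' {(pentagonal k : ℤ)} = {k} := by
      ext i
      simp
    rw [coeff_pentagonalSeries_pentagonal, coeff_series, this, finsum_mem_singleton, Int.cast_id]
  · rw [coeff_pentagonalSeries_eq_zero ℤ h, coeff_series_eq_zero]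
    exact fun i hi => h ⟨i, by exact_mod_cast hi⟩

theorem dissect_two_zero_phi : dissect 2 0 phi = expand 2 two_ne_zero phi := by
  rw [phi, expand_series]
  refine dissect_series two_ne_zero (fun m => 2 * m) (mul_right_injective₀ two_ne_zero)
    (fun m => by push_cast; ring) (fun _ => rfl) fun n hn => ?_
  have : (2 : ℤ) ∣ n := Int.prime_two.dvd_of_dvd_pow (Int.modEq_zero_iff_dvd.1 hn)
  exact this.imp fun m hm => hm.symm

theorem dissect_two_one_phi : dissect 2 1 phi = 2 * expand 4 four_ne_zero psi := by
  rw [phi, psi, expand_series]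
  refine dissect_series_of_neg isExponent_sq (fun n => neg_sq n) two_ne_zero (fun m => 4 * m + 1)
    (fun m m' h => by simpa using h) (fun m => by push_cast; ring) (fun m m' => by omega)
    fun n hn => ?_
  have : Odd n := (Int.odd_pow' two_ne_zero).1 (Int.odd_iff.2 hn)
  obtain h | h : n % 4 = 1 ∨ n % 4 = 3 := by grind
  exacts [⟨n / 4, by omega⟩, ⟨-n / 4, by omega⟩]

theorem dissect_three_zero_phi : dissect 3 0 phi = expand 3 three_ne_zero phi := by
  rw [phi, expand_series]
  refine dissect_series three_ne_zero (fun m => 3 * m) (mul_right_injective₀ three_ne_zero)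
    (fun m => by push_cast; ring) (fun _ => rfl) fun n hn => ?_
  have : (3 : ℤ) ∣ n := Int.prime_three.dvd_of_dvd_pow (Int.modEq_zero_iff_dvd.1 hn)
  exact this.imp fun m hm => hm.symm

theorem dissect_three_one_phi : dissect 3 1 phi = 2 * omega := by
  rw [phi, omega]
  refine dissect_series_of_neg isExponent_sq (fun n => neg_sq n) three_ne_zero (fun m => 3 * m + 1)
    (fun m m' h => by simpa using h) (fun m => by push_cast; ring) (fun m m' => by omega)
    fun n hn => ?_
  obtain h | h | h : n % 3 = 0 ∨ n % 3 = 1 ∨ n % 3 = 2 := by omega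
  · simp [Int.ModEq, sq, Int.mul_emod, h] at hn
  exacts [⟨n / 3, by omega⟩, ⟨-n / 3, by omega⟩]

theorem dissect_three_two_phi : dissect 3 2 phi = 0 := by
  ext n
  rw [coeff_dissect, phi, coeff_series_eq_zero, map_zero]
  intro i hi
  have := congrArg (· % 3) hi
  obtain h | h | h : i % 3 = 0 ∨ i % 3 = 1 ∨ i % 3 = 2 := by omega
  all_goals simp [sq, Int.mul_emod, h] at this

theorem dissect_two_zero_phi_sq : dissect 2 0 (phi ^ 2) = phi ^ 2 := by
  rw [sq, phi, series_mul_series isExponent_sq isExponent_sq]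
  refine dissect_series two_ne_zero (fun x : ℤ × ℤ => (x.1 + x.2, x.1 - x.2)) ?_
    (fun x => by push_cast; ring) (fun _ => rfl) ?_
  · rintro ⟨a, b⟩ ⟨c, d⟩ h
    grind
  · rintro ⟨a, b⟩ h
    have h' : Even (a + b) := by
      simpa [Int.even_add, Int.even_pow] using Int.even_iff.2 h
    exact ⟨((a + b) / 2, (a - b) / 2), by grind⟩

theorem dissect_two_one_phi_mul_phi :
    dissect 2 1 (phi * expand 3 three_ne_zero phi) = 2 * (psi * expand 3 three_ne_zero psi) := by
  have h3 : IsExponent fun n : ℤ => (3 : ℕ) * n ^ 2 := isExponent_sq.const_mul (by norm_num)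
  rw [phi, psi, expand_series, expand_series, series_mul_series isExponent_sq h3,
    series_mul_series isExponent_two_mul_sq_add
      (isExponent_two_mul_sq_add.const_mul (by norm_num))]
  simp only [mul_one]
  refine dissect_series_of_neg (isExponent_sq.add h3) (fun x => by simp) two_ne_zero
    (fun x : ℤ × ℤ => (x.1 + 3 * x.2 + 1, x.1 - x.2)) ?_ (fun x => by push_cast; ring) ?_ ?_
  · rintro ⟨a, b⟩ ⟨c, d⟩ h
    grind
  · rintro ⟨a, b⟩ ⟨c, d⟩ h
    rw [Prod.neg_mk, Prod.mk.injEq] at h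
    omega
  · rintro ⟨a, b⟩ h
    have hodd : Odd (a + b) := by
      have : Odd (a ^ 2 + 3 * b ^ 2) := Int.odd_iff.2 h
      simpa [parity_simps, show ¬ Even (3 : ℤ) by decide] using this
    obtain hab | hab : (a - b) % 4 = 1 ∨ (a - b) % 4 = 3 := by grind
    · exact ⟨((a + 3 * b - 1) / 4, (a - b - 1) / 4), Or.inl (Prod.ext (by grind) (by grind))⟩
    · refine ⟨((-a - 3 * b - 1) / 4, (b - a - 1) / 4), Or.inr (Prod.ext ?_ ?_)⟩
      all_goals
        rw [Prod.neg_mk]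
        grind

theorem dissect_two_zero_phi_mul_omega :
    dissect 2 0 (expand 3 three_ne_zero phi * evalNegHom omega) =
      expand 2 two_ne_zero (euler ^ 2) := by
  rw [sq, euler_eq_series, phi, omega, expand_series, evalNegHom_series,
    series_mul_series isExponent_pentagonal isExponent_pentagonal, expand_series,
    series_mul_series (isExponent_sq.const_mul (by norm_num))
      (isExponent_quadratic (by norm_num))]
  refine dissect_series two_ne_zero (fun x : ℤ × ℤ => (x.1 - x.2, -(x.1 + x.2))) ?_ ?_ ?_ ?_
  · rintro ⟨a, b⟩ ⟨c, d⟩ h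
    grind
  · rintro ⟨a, b⟩
    have ha := two_mul_natCast_pentagonal a
    have hb := two_mul_natCast_pentagonal b
    push_cast
    linear_combination -2 * ha - 2 * hb
  · rintro ⟨a, b⟩
    have : (3 * (-(a + b)) ^ 2 + 2 * -(a + b)).negOnePow = (a + b).negOnePow :=
      (Int.negOnePow_eq_iff _ _).2 <| by
        simp [parity_simps, show ¬ Even (3 : ℤ) by decide, iff_comm]
    rw [one_mul, mul_one, this, Int.negOnePow_add, Units.val_mul, Int.cast_id]
  · rintro ⟨a, b⟩ h
    have : Even (a - b) := by
      have : Even (3 * a ^ 2 + (3 * b ^ 2 + 2 * b)) := Int.even_iff.2 h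
      simpa [parity_simps, show ¬ Even (3 : ℤ) by decide] using this
    exact ⟨((a - b) / 2, (-a - b) / 2), Prod.ext (by grind) (by grind)⟩

theorem phi_two_dissection : phi = V[4] phi + 2 * X * V[8] psi := by
  conv_lhs => rw [eq_expand_two_add phi, dissect_two_zero_phi, dissect_two_one_phi]
  simp only [map_mul, map_ofNat, ← expand_mul, Nat.reduceMul]
  ring

theorem phi_three_dissection : phi = V[9] phi + 2 * X * V[3] omega := by
  conv_lhs => rw [eq_sum_X_pow_mul_expand_dissect three_ne_zero phi]
  simp only [Finset.sum_range_succ, Finset.sum_range_zero, dissect_three_zero_phi,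
    dissect_three_one_phi, dissect_three_two_phi, map_mul, map_ofNat, map_zero, ← expand_mul,
    Nat.reduceMul]
  ring

end Theta

section Identities

instance instCharZero : CharZero ℤ⟦X⟧ := charZero_of_injective_ringHom (C_injective (R := ℤ))

theorem constantCoeff_series {ι R : Type*} [CommRing R] {e : ι → ℤ} {i₀ : ι}
    (h : ∀ i, e i = 0 ↔ i = i₀) (w : ι → R) : constantCoeff (series e w) = w i₀ := by
  have : e ⁻¹' {((0 : ℕ) : ℤ)} = {i₀} := by
    ext i
    simp [h]
  rw [← coeff_zero_eq_constantCoeff_apply, coeff_series, this, finsum_mem_singleton]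

@[simp]
theorem constantCoeff_phi : constantCoeff phi = 1 :=
  constantCoeff_series (i₀ := 0) (fun n => by simp) _

@[simp]
theorem constantCoeff_psi : constantCoeff psi = 1 := by
  refine constantCoeff_series (i₀ := 0) (fun n => ⟨fun h => ?_, fun h => by simp [h]⟩) _
  nlinarith [sq_le_quadratic (a := 2) (b := 1) (by simp) n]

@[simp]
theorem constantCoeff_euler : constantCoeff euler = 1 := by
  simpa [pentagonal_def] using coeff_pentagonalSeries_pentagonal ℤ 0

theorem ne_zero_of_constantCoeff_eq_one {R : Type*} [CommRing R] [Nontrivial R] {f : R⟦X⟧}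
    (hf : constantCoeff f = 1) : f ≠ 0 := by
  rintro rfl
  simp at hf

theorem phi_sq_two_dissection : phi ^ 2 = V[2] (V[2] phi ^ 2 + 4 * X * V[4] psi ^ 2) +
    X * V[2] (4 * V[2] (phi * V[2] psi)) := by
  conv_lhs => rw [phi_two_dissection]
  simp only [map_add, map_mul, map_pow, map_ofNat, expand_X, ← expand_mul, Nat.reduceMul]
  ring

theorem phi_sq : phi ^ 2 = V[2] phi ^ 2 + 4 * X * V[4] psi ^ 2 := by
  rw [← dissect_two_zero_phi_sq, phi_sq_two_dissection, dissect_two_zero_add]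

theorem psi_sq : psi ^ 2 = phi * V[2] psi := by
  have h : phi ^ 2 = V[2] (phi ^ 2) + X * V[2] (4 * V[2] (psi ^ 2)) := by
    conv_lhs => rw [phi_sq]
    simp only [map_mul, map_pow, map_ofNat, ← expand_mul, Nat.reduceMul]
    ring
  have h4 : 4 * V[2] (psi ^ 2) = 4 * V[2] (phi * V[2] psi) := by
    rw [← dissect_two_one_add (phi ^ 2) (4 * _), ← h, phi_sq_two_dissection, dissect_two_one_add]
  exact expand_two_injective (mul_left_cancel₀ (OfNat.ofNat_ne_zero 4) h4)

theorem evalNegHom_phi_sq : evalNegHom phi ^ 2 = V[2] phi ^ 2 - 4 * X * V[4] psi ^ 2 := by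
  rw [← map_pow, phi_sq]
  simp only [map_add, map_mul, map_pow, map_ofNat, evalNegHom_X,
    evalNegHom_expand_of_even (NeZero.ne _) (by decide : Even 2),
    evalNegHom_expand_of_even (NeZero.ne _) (by decide : Even 4)]
  ring

theorem evalNegHom_phi_two_dissection :
    evalNegHom phi = V[4] phi - 2 * X * V[8] psi := by
  conv_lhs => rw [phi_two_dissection]
  simp only [map_add, map_mul, map_ofNat, evalNegHom_X,
    evalNegHom_expand_of_even (NeZero.ne _) (by decide : Even 8),
    evalNegHom_expand_of_even (NeZero.ne _) (by decide : Even 4)]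
  ring

theorem phi_mul_evalNegHom_phi : phi * evalNegHom phi = V[2] (evalNegHom phi) ^ 2 := by
  rw [← map_pow, evalNegHom_phi_sq, evalNegHom_phi_two_dissection]
  nth_rw 1 [phi_two_dissection]
  simp only [map_sub, map_mul, map_pow, map_ofNat, expand_X, ← expand_mul, Nat.reduceMul]
  ring

theorem evalNegHom_psi_mul : evalNegHom psi * V[2] (evalNegHom phi) = psi * evalNegHom phi := by
  have hsq : (evalNegHom psi * V[2] (evalNegHom phi)) ^ 2 = (psi * evalNegHom phi) ^ 2 := by
    have h : evalNegHom psi ^ 2 = evalNegHom phi * V[2] psi := by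
      rw [← map_pow, psi_sq, map_mul, evalNegHom_expand_of_even (NeZero.ne _) even_two]
    rw [mul_pow, mul_pow, h, psi_sq, ← phi_mul_evalNegHom_phi]
    ring
  refine (sq_eq_sq_iff_eq_or_eq_neg.1 hsq).resolve_right fun h => ?_
  have := congrArg constantCoeff h
  simp [constantCoeff_evalNegHom] at this

theorem psi_mul_psi_two_dissection :
    psi * V[3] psi = V[4] psi * V[6] phi + X * (V[2] phi * V[12] psi) := by
  have h : phi * V[3] phi = V[2] (V[2] phi * V[6] phi + 4 * X ^ 2 * (V[4] psi * V[12] psi)) +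
      X * V[2] (2 * (V[4] psi * V[6] phi + X * (V[2] phi * V[12] psi))) := by
    conv_lhs => rw [phi_two_dissection]
    simp only [map_add, map_mul, map_pow, map_ofNat, expand_X, ← expand_mul, Nat.reduceMul]
    ring
  refine mul_left_cancel₀ (two_ne_zero (α := ℤ⟦X⟧)) ?_
  rw [← dissect_two_one_phi_mul_phi, h, dissect_two_one_add]

theorem dissect_two_one_psi_mul_psi : dissect 2 1 (psi * V[3] psi) = phi * V[6] psi := by
  have h : psi * V[3] psi = V[2] (V[2] psi * V[3] phi) + X * V[2] (phi * V[6] psi) := by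
    simp only [psi_mul_psi_two_dissection, map_mul, ← expand_mul, Nat.reduceMul]
  rw [h, dissect_two_one_add]

theorem dissect_two_one_phi_mul_evalNegHom_phi :
    dissect 2 1 (phi * V[3] (evalNegHom phi)) =
      2 * (evalNegHom psi * V[3] (evalNegHom psi)) := by
  have h : phi * V[3] (evalNegHom phi) =
      V[2] (V[2] phi * V[6] phi - 4 * X ^ 2 * (V[4] psi * V[12] psi)) +
        X * V[2] (2 * evalNegHom (psi * V[3] psi)) := by
    rw [evalNegHom_phi_two_dissection, psi_mul_psi_two_dissection]
    nth_rw 1 [phi_two_dissection]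
    simp only [map_add, map_sub, map_mul, map_neg, map_pow, map_ofNat, expand_X, evalNegHom_X,
      evalNegHom_expand_of_even (NeZero.ne _) (by decide : Even 2),
      evalNegHom_expand_of_even (NeZero.ne _) (by decide : Even 4),
      evalNegHom_expand_of_even (NeZero.ne _) (by decide : Even 6),
      evalNegHom_expand_of_even (NeZero.ne _) (by decide : Even 12), ← expand_mul, Nat.reduceMul]
    ring
  rw [h, dissect_two_one_add, map_mul, evalNegHom_expand_of_odd _ (by decide)]

theorem evalNegHom_phi_three_dissection :
    evalNegHom phi = V[9] (evalNegHom phi) - 2 * X * V[3] (evalNegHom omega) := by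
  conv_lhs => rw [phi_three_dissection]
  simp only [map_add, map_mul, map_ofNat, evalNegHom_X,
    evalNegHom_expand_of_odd (NeZero.ne _) (by decide : Odd 9),
    evalNegHom_expand_of_odd (NeZero.ne _) (by decide : Odd 3)]
  ring

theorem phi_mul_evalNegHom_omega_add :
    V[3] phi * evalNegHom omega + V[3] (evalNegHom phi) * omega = 2 * V[4] (euler ^ 2) := by
  have h := add_evalNegHom (V[3] phi * evalNegHom omega)
  rwa [map_mul, evalNegHom_evalNegHom, evalNegHom_expand_of_odd _ (by decide),
    dissect_two_zero_phi_mul_omega, ← expand_mul] at h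

end Identities

section Products

open Filter Topology
open scoped PowerSeries.WithPiTopology
open PowerSeries.WithPiTopology

theorem continuous_expand {k : ℕ} (hk : k ≠ 0) : Continuous (expand (R := ℤ) k hk) := by
  refine continuous_iff_continuousAt.2 fun f => (tendsto_iff_coeff_tendsto ℤ _ _ _).2 fun d => ?_
  simp only [coeff_expand]
  split_ifs
  · exact (continuous_coeff ℤ _).continuousAt
  · exact tendsto_const_nhds

/-- The product `∏ (1 - q ^ n)` over the elements `n` of `S`. -/
noncomputable def prodOn (S : Set ℕ) : ℤ⟦X⟧ := ∏' n : S, (1 - X ^ (n : ℕ))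

theorem multipliable_prodOn (S : Set ℕ) : Multipliable fun n : S => (1 : ℤ⟦X⟧) - X ^ (n : ℕ) := by
  refine (multipliable_subtype_iff_mulIndicator (f := fun n => (1 : ℤ⟦X⟧) - X ^ n)).2 ?_
  have h : S.mulIndicator (fun n => (1 : ℤ⟦X⟧) - X ^ n) =
      fun n => 1 + S.indicator (fun n => -X ^ n) n := by
    ext1 n
    by_cases hn : n ∈ S <;> simp [hn, sub_eq_add_neg]
  rw [h]
  refine multipliable_one_add_of_tendsto_order_atTop_nhds_top _ ?_
  refine tendsto_nhds_top_mono' ENat.tendsto_natCast_nhds_top fun n => ?_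
  by_cases hn : n ∈ S <;> simp [hn]

theorem hasProd_prodOn (S : Set ℕ) :
    HasProd (S.mulIndicator fun n => (1 : ℤ⟦X⟧) - X ^ n) (prodOn S) :=
  hasProd_subtype_iff_mulIndicator.1 (multipliable_prodOn S).hasProd

theorem constantCoeff_prodOn {S : Set ℕ} (h0 : 0 ∉ S) : constantCoeff (prodOn S) = 1 := by
  refine ((hasProd_prodOn S).map constantCoeff (continuous_constantCoeff ℤ)).unique ?_
  convert hasProd_one with n
  by_cases hn : n ∈ S
  · simp [hn, ne_of_mem_of_not_mem hn h0]
  · simp [hn]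

theorem prodOn_union {S T : Set ℕ} (h : Disjoint S T) : prodOn (S ∪ T) = prodOn S * prodOn T :=
  (multipliable_prodOn S).tprod_union_disjoint (f := fun n => (1 : ℤ⟦X⟧) - X ^ n) h
    (multipliable_prodOn T)

theorem prodOn_range {f : ℕ → ℕ} (hf : Function.Injective f) :
    HasProd (fun n => (1 : ℤ⟦X⟧) - X ^ f n) (prodOn (Set.range f)) :=
  (hf.hasProd_range_iff (f := fun n => (1 : ℤ⟦X⟧) - X ^ n)).1 (multipliable_prodOn _).hasProd

theorem expand_prodOn {k : ℕ} (hk : k ≠ 0) (S : Set ℕ) :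
    expand k hk (prodOn S) = prodOn ((k * ·) '' S) := by
  rw [prodOn, prodOn, (multipliable_prodOn S).map_tprod _ (continuous_expand hk),
    tprod_image (fun n => (1 : ℤ⟦X⟧) - X ^ n) (mul_right_injective₀ hk).injOn]
  simp [pow_mul]

theorem hasSum_series {ι : Type*} {e : ι → ℤ} (he : IsExponent e) :
    HasSum (fun i => (X : ℤ⟦X⟧) ^ (e i).toNat) (series e fun _ => 1) := by
  refine (hasSum_iff_hasSum_coeff ℤ).2 fun n => ?_
  have hmem (i : ι) : i ∈ (he.finite n).toFinset ↔ n = (e i).toNat := by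
    have := he.nonneg i
    simp only [Set.Finite.mem_toFinset, Set.mem_preimage, Set.mem_singleton_iff]
    omega
  simp only [coeff_X_pow, coeff_series_eq_sum he]
  rw [Finset.sum_congr rfl fun i hi => (if_pos ((hmem i).1 hi)).symm]
  exact hasSum_sum_of_ne_finset_zero fun i hi => if_neg (mt (hmem i).2 hi)

end Products

section Gauss

/-- The summand of Shanks's finite form of Gauss's identity for `psi`. -/
def shanksTerm {R : Type*} [CommRing R] (q : R) (n s : ℕ) : R :=
  (∏ i ∈ Finset.range s, (1 - q ^ (2 * i + 1))) * (∏ i ∈ Finset.Ico s n, (1 - q ^ (2 * (i + 1)))) *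
    (q ^ (2 * n + 1)) ^ s

theorem shanksTerm_succ_succ {R : Type*} [CommRing R] (q : R) {n s : ℕ} (h : s < n) :
    (1 - q ^ (2 * (s + 1))) * shanksTerm q n (s + 1) =
      (1 - q ^ (2 * s + 1)) * q ^ (2 * n + 1) * shanksTerm q n s := by
  rw [shanksTerm, shanksTerm, Finset.prod_range_succ, Finset.prod_eq_prod_Ico_succ_bot h]
  ring

theorem shanksTerm_succ_left {R : Type*} [CommRing R] (q : R) {n s : ℕ} (h : s ≤ n) :
    shanksTerm q (n + 1) s = (1 - q ^ (2 * (n + 1))) * q ^ (2 * s) * shanksTerm q n s := by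
  rw [shanksTerm, shanksTerm, Finset.prod_Ico_succ_top h]
  ring

/-- The recurrence in `n` holds because the difference of its two sides telescopes. -/
theorem sum_shanksTerm_succ {R : Type*} [CommRing R] (q : R) (n : ℕ) {k : ℕ} (h : k ≤ n) :
    ∑ s ∈ Finset.range k, shanksTerm q (n + 1) s =
      (1 - q ^ (2 * n + 1)) * ∑ s ∈ Finset.range k, shanksTerm q n s +
        (1 - q ^ (2 * k)) * shanksTerm q n k := by
  induction k with
  | zero => simp
  | succ k ih =>
    rw [Finset.sum_range_succ, Finset.sum_range_succ, ih (by omega), shanksTerm_succ_succ q h,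
      shanksTerm_succ_left q (by omega)]
    ring

/-- **Shanks's finite form of Gauss's identity** for `psi`. -/
theorem prod_mul_sum_eq_sum_shanksTerm {R : Type*} [CommRing R] (q : R) (n : ℕ) :
    (∏ i ∈ Finset.range n, (1 - q ^ (2 * i + 1))) *
      ∑ k ∈ Finset.range n, (q ^ (k * (2 * k + 1)) + q ^ ((k + 1) * (2 * k + 1))) =
    ∑ s ∈ Finset.range n, shanksTerm q n s := by
  induction n with
  | zero => simp
  | succ n ih =>
    rw [Finset.sum_range_succ _ n, Finset.sum_range_succ _ n, sum_shanksTerm_succ q n le_rfl, ← ih,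
      shanksTerm_succ_left q le_rfl, shanksTerm, Finset.Ico_self, Finset.prod_empty,
      Finset.prod_range_succ]
    ring

open Filter Topology
open scoped PowerSeries.WithPiTopology
open PowerSeries.WithPiTopology

theorem hasSum_psi :
    HasSum (fun k : ℕ => (X : ℤ⟦X⟧) ^ (k * (2 * k + 1)) + X ^ ((k + 1) * (2 * k + 1))) psi := by
  have h : HasSum _ psi := hasSum_series isExponent_two_mul_sq_add
  convert h.nat_add_neg_add_one using 4 with k k
  all_goals
    refine Nat.cast_injective (R := ℤ) ?_
    rw [Int.toNat_of_nonneg (isExponent_two_mul_sq_add.nonneg _)]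
    push_cast
    ring

theorem tendsto_X_pow_mul (f : ℕ → ℤ⟦X⟧) : Tendsto (fun n => X ^ n * f n) atTop (𝓝 0) := by
  refine (tendsto_iff_coeff_tendsto ℤ _ _ _).2 fun d => tendsto_nhds_of_eventually_eq ?_
  filter_upwards [eventually_gt_atTop d] with n hn
  rw [coeff_X_pow_mul', if_neg hn.not_ge, map_zero]

theorem tendsto_sum_shanksTerm :
    Tendsto (fun n => ∑ s ∈ Finset.range n, shanksTerm (X : ℤ⟦X⟧) n s) atTop
      (𝓝 (V[2] euler)) := by
  have h0 : Tendsto (fun n => ∏ i ∈ Finset.range n, (1 - (X : ℤ⟦X⟧) ^ (2 * (i + 1)))) atTop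
      (𝓝 (V[2] euler)) := by
    have := ((hasProd_one_sub_X_pow ℤ).map _ (continuous_expand two_ne_zero)).tendsto_prod_nat
    simpa [Function.comp_def, ← pow_mul] using this
  rw [← tendsto_add_atTop_iff_nat 1] at h0 ⊢
  have h1 := h0.add (tendsto_X_pow_mul fun n => X ^ (n + 3) *
    ∑ s ∈ Finset.range n, (∏ i ∈ Finset.range (s + 1), (1 - X ^ (2 * i + 1))) *
      (∏ i ∈ Finset.Ico (s + 1) (n + 1), (1 - X ^ (2 * (i + 1)))) * (X ^ (2 * (n + 1) + 1)) ^ s)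
  rw [add_zero] at h1
  refine h1.congr fun n => ?_
  rw [Finset.sum_range_succ', add_comm, ← mul_assoc, Finset.mul_sum]
  congr 1
  · refine Finset.sum_congr rfl fun s _ => ?_
    rw [shanksTerm]
    ring
  · simp [shanksTerm]

end Gauss

section EulerProducts

open Filter Topology
open scoped PowerSeries.WithPiTopology
open PowerSeries.WithPiTopology

/-- The product `∏ (1 - q ^ (2 * n + 1))`. -/
noncomputable abbrev oddProd : ℤ⟦X⟧ := prodOn {n | Odd n}

theorem hasProd_oddProd : HasProd (fun n => (1 : ℤ⟦X⟧) - X ^ (2 * n + 1)) oddProd := by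
  have hinj : Function.Injective fun n : ℕ => 2 * n + 1 := fun m n h => by simpa using h
  rw [oddProd, ← range_two_mul_add_one]
  exact prodOn_range hinj

theorem oddProd_mul_psi : oddProd * psi = V[2] euler := by
  refine tendsto_nhds_unique ?_ tendsto_sum_shanksTerm
  refine (hasProd_oddProd.tendsto_prod_nat.mul hasSum_psi.tendsto_sum_nat).congr fun n => ?_
  exact prod_mul_sum_eq_sum_shanksTerm X n

theorem euler_eq_prodOn : euler = prodOn {n | 0 < n} := by
  have hrange : Set.range Nat.succ = {n | 0 < n} := by
    ext n
    simp [Nat.pos_iff_ne_zero]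
  refine (hasProd_one_sub_X_pow ℤ).unique ?_
  rw [← hrange]
  exact prodOn_range Nat.succ_injective

theorem euler_eq_oddProd_mul : euler = oddProd * V[2] euler := by
  have hdisj : Disjoint {n | Odd n} ((2 * ·) '' {n : ℕ | 0 < n}) := by
    rw [Set.disjoint_left]
    rintro _ h ⟨n, -, rfl⟩
    exact Nat.not_odd_iff_even.2 (even_two_mul n) h
  rw [euler_eq_prodOn, expand_prodOn, ← prodOn_union hdisj]
  congr 1
  ext n
  refine ⟨fun hn => (Nat.even_or_odd' n).elim fun m hm => ?_, ?_⟩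
  · exact hm.symm.imp (fun h => ⟨m, h⟩) fun h => ⟨m, by grind, h.symm⟩
  · rintro (h | ⟨m, hm, rfl⟩)
    exacts [h.pos, by simpa using hm]

theorem continuous_evalNegHom : Continuous (evalNegHom (A := ℤ)) := by
  refine continuous_iff_continuousAt.2 fun f => (tendsto_iff_coeff_tendsto ℤ _ _ _).2 fun d => ?_
  simp only [coeff_evalNegHom]
  exact ((continuous_coeff ℤ d).const_mul _).continuousAt

theorem oddProd_mul_evalNegHom_oddProd : oddProd * evalNegHom oddProd = V[2] oddProd := by
  have h := hasProd_oddProd.mul (hasProd_oddProd.map _ continuous_evalNegHom)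
  refine h.unique ?_
  convert hasProd_oddProd.map _ (continuous_expand two_ne_zero) using 2 with n
  simp only [Function.comp_apply, map_sub, map_one, map_pow, evalNegHom_X, expand_X,
    (odd_two_mul_add_one n).neg_pow, sub_neg_eq_add, ← pow_mul]
  ring

@[simp]
theorem constantCoeff_oddProd : constantCoeff oddProd = 1 :=
  constantCoeff_prodOn (by simp)

theorem phi_mul_oddProd_sq : phi * oddProd ^ 2 = V[2] (oddProd ^ 2 * euler) := by
  have hψ := congrArg (V[2]) oddProd_mul_psi
  have hE := congrArg (V[2]) euler_eq_oddProd_mul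
  have hne : V[2] (V[2] euler) ≠ 0 := ne_zero_of_constantCoeff_eq_one (by simp)
  rw [map_mul] at hψ hE
  refine mul_right_cancel₀ hne ?_
  rw [map_mul, map_pow]
  linear_combination -phi * oddProd ^ 2 * hψ - V[2] oddProd * oddProd ^ 2 * psi_sq +
    V[2] oddProd * (oddProd * psi + V[2] euler) * oddProd_mul_psi + V[2] oddProd * V[2] euler * hE

theorem evalNegHom_phi_eq : evalNegHom phi = oddProd ^ 2 * V[2] euler := by
  have h := congrArg evalNegHom phi_mul_oddProd_sq
  have hne : V[2] oddProd ≠ 0 := ne_zero_of_constantCoeff_eq_one (by simp)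
  rw [map_mul, evalNegHom_expand_of_even _ even_two, map_mul, map_pow, map_pow] at h
  refine mul_right_cancel₀ (pow_ne_zero 2 hne) ?_
  linear_combination oddProd ^ 2 * h - evalNegHom phi *
    (V[2] oddProd + oddProd * evalNegHom oddProd) * oddProd_mul_evalNegHom_oddProd

theorem evalNegHom_phi_mul_euler : evalNegHom phi * V[2] euler = euler ^ 2 := by
  rw [evalNegHom_phi_eq]
  conv_rhs => rw [euler_eq_oddProd_mul]
  ring

end EulerProducts

section GeneratingFunction

open scoped PowerSeries.WithPiTopology
open PowerSeries.WithPiTopology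

theorem hasProd_prodOn_succ {S : Set ℕ} (h0 : 0 ∉ S) :
    HasProd (fun i => S.mulIndicator (fun n => (1 : ℤ⟦X⟧) - X ^ n) (i + 1)) (prodOn S) := by
  refine ((add_left_injective 1).hasProd_iff
    (f := S.mulIndicator fun n => (1 : ℤ⟦X⟧) - X ^ n) (a := prodOn S) fun n hn => ?_).2
    (hasProd_prodOn S)
  refine Set.mulIndicator_of_notMem (fun hS => hn ?_) _
  exact ⟨n - 1, Nat.sub_add_cancel (Nat.pos_of_ne_zero (ne_of_mem_of_not_mem hS h0))⟩

theorem one_add_two_mul_tsum_pow_mul {f : ℤ⟦X⟧} (hf : constantCoeff f = 0) :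
    (1 + ∑' j, 2 * f ^ (j + 1)) * (1 - f) ^ 2 = 1 - f ^ 2 := by
  have hs := summable_pow_of_constantCoeff_eq_zero hf
  have h : ∑' j, 2 * f ^ (j + 1) = 2 * f * ∑' j, f ^ j := by
    rw [← hs.tsum_mul_left]
    exact tsum_congr fun j => by ring
  rw [h]
  linear_combination 2 * f * (1 - f) * tsum_pow_mul_one_sub_of_constantCoeff_eq_zero hf

/-- The left factor is the generating function of the overpartitions with parts in `S`. -/
theorem genFun_mul_prodOn_sq {S : Set ℕ} [DecidablePred (· ∈ S)] (h0 : 0 ∉ S) :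
    Nat.Partition.genFun (fun i _ => if i ∈ S then (2 : ℤ) else 0) * prodOn S ^ 2 =
      V[2] (prodOn S) := by
  have h := hasProd_prodOn_succ h0
  rw [sq]
  refine ((Nat.Partition.hasProd_genFun _).mul (h.mul h)).unique ?_
  convert h.map _ (continuous_expand two_ne_zero) using 2 with i
  · rfl
  simp only [smul_eq_C_mul]
  by_cases hi : i + 1 ∈ S
  · have hX := one_add_two_mul_tsum_pow_mul (f := X ^ (i + 1)) (by simp)
    simp only [← pow_mul] at hX
    simpa [hi, ← sq, ← pow_mul, mul_comm 2] using hX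
  · simp [hi]

theorem schurOverpartitionCount_eq_sum (t n : ℕ) :
    schurOverpartitionCount t n = ∑ p : n.Partition,
      if ∀ i ∈ p.parts, i % (2 * t) ∈ schurResidues t then 2 ^ p.parts.toFinset.card else 0 := by
  let e : SchurOverpartition t n ≃ Σ p : {p : n.Partition // ∀ i ∈ p.parts,
      i % (2 * t) ∈ schurResidues t}, p.1.parts.toFinset.powerset :=
    { toFun := fun P => ⟨⟨P.partition, P.residue_mem⟩,
        ⟨P.overlined, Finset.mem_powerset.mpr P.overlined_subset⟩⟩
      invFun := fun P => ⟨P.1.1, P.1.2, P.2.1, Finset.mem_powerset.mp P.2.2⟩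
      left_inv := fun _ => rfl
      right_inv := fun _ => rfl }
  rw [schurOverpartitionCount, Nat.card_congr e, Nat.card_sigma, ← Finset.sum_filter]
  simp only [Nat.card_eq_fintype_card, Fintype.card_coe, Finset.card_powerset]
  exact (Finset.sum_subtype _ (by simp) fun p : n.Partition => 2 ^ p.parts.toFinset.card).symm

/-- The generating function `∑ schurOverpartitionCount t n * q ^ n`. -/
noncomputable def schurSeries (t : ℕ) : ℤ⟦X⟧ :=
  PowerSeries.mk fun n => (schurOverpartitionCount t n : ℤ)

theorem schurSeries_eq_genFun (t : ℕ) : schurSeries t =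
    Nat.Partition.genFun fun i _ => if i % (2 * t) ∈ schurResidues t then (2 : ℤ) else 0 := by
  ext n
  rw [schurSeries, coeff_mk, Nat.Partition.coeff_genFun, schurOverpartitionCount_eq_sum]
  push_cast
  refine Finset.sum_congr rfl fun p _ => ?_
  rw [Finsupp.prod, Finset.prod_ite_zero, Finset.prod_const]
  simp

theorem coeff_schurSeries_pow (t r n : ℕ) :
    coeff n (schurSeries t ^ r) = schurOverpartitionTupleCount t r n := by
  classical
  rw [schurOverpartitionTupleCount, Nat.card_sigma]
  simp only [Nat.card_pi]
  rw [← Fin.prod_const, coeff_prod]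
  simp only [schurSeries, coeff_mk, schurOverpartitionCount]
  push_cast
  rw [Finset.univ_eq_attach, Finset.sum_attach (Finset.finAntidiagonal r n)
    fun s => ∏ j, (Nat.card (SchurOverpartition t (s j)) : ℤ)]
  refine Finset.sum_bij (fun l _ => (l : Fin r → ℕ)) ?_ ?_ ?_ ?_
  · intro l hl
    simpa [Finset.mem_finsuppAntidiag] using hl
  · exact fun a _ b _ h => DFunLike.coe_injective h
  · intro s hs
    exact ⟨Finsupp.equivFunOnFinite.symm s, by simpa [Finset.mem_finsuppAntidiag] using hs, rfl⟩
  · exact fun l _ => rfl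

theorem schurOverpartitionTupleCount_one (t n : ℕ) :
    schurOverpartitionTupleCount t 1 n = schurOverpartitionCount t n := by
  have h := coeff_schurSeries_pow t 1 n
  rw [pow_one, schurSeries, coeff_mk] at h
  exact_mod_cast h.symm

/-- The product `∏ (1 - q ^ n)` over the possible parts `n` of a `t`-Schur overpartition. -/
noncomputable abbrev schurProd (t : ℕ) : ℤ⟦X⟧ := prodOn {n | n % (2 * t) ∈ schurResidues t}

theorem schurSeries_mul_schurProd_sq (t : ℕ) :
    schurSeries t * schurProd t ^ 2 = V[2] (schurProd t) := by
  rw [schurSeries_eq_genFun]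
  exact genFun_mul_prodOn_sq (S := {n | n % (2 * t) ∈ schurResidues t}) (by simp [schurResidues])

theorem mod_mem_schurResidues_iff {t : ℕ} (ht : Odd t) {n : ℕ} :
    n % (2 * t) ∈ schurResidues t ↔ Odd n ∧ ¬ t ∣ n := by
  have hlt : n % (2 * t) < 2 * t := Nat.mod_lt n (by have := ht.pos; omega)
  have hodd : Odd (n % (2 * t)) ↔ Odd n := by
    rw [Nat.odd_iff, Nat.odd_iff, Nat.mod_mod_of_dvd n (dvd_mul_right 2 t)]
  have hdvd : t ∣ n % (2 * t) ↔ t ∣ n := Nat.dvd_mod_iff (dvd_mul_left t 2)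
  simp only [schurResidues, Finset.mem_filter, Finset.mem_range, hlt, hodd, true_and]
  refine and_congr_right fun hn => not_congr (Iff.trans ⟨fun h => h.symm.dvd, ?_⟩ hdvd)
  rintro ⟨m, hm⟩
  have hm2 : m < 2 := by
    rw [hm, mul_comm] at hlt
    exact lt_of_mul_lt_mul_right hlt t.zero_le
  have hm0 : m ≠ 0 := by
    rintro rfl
    simp [hm, ← hodd] at hn
  rw [hm, show m = 1 by omega, mul_one]

theorem oddProd_eq_schurProd_mul {t : ℕ} (ht : Odd t) :
    oddProd = schurProd t * expand t ht.pos.ne' oddProd := by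
  have hdisj : Disjoint {n | n % (2 * t) ∈ schurResidues t} ((t * ·) '' {n | Odd n}) := by
    rw [Set.disjoint_left]
    rintro _ h ⟨n, -, rfl⟩
    exact ((mod_mem_schurResidues_iff ht).1 h).2 (dvd_mul_right t n)
  have hunion : {n | Odd n} = {n | n % (2 * t) ∈ schurResidues t} ∪ (t * ·) '' {n | Odd n} := by
    ext n
    by_cases hn : t ∣ n
    · obtain ⟨m, rfl⟩ := hn
      simp [mod_mem_schurResidues_iff ht, Nat.odd_mul, ht, ht.pos.ne']
    · have : ∀ m, t * m ≠ n := fun m h => hn ⟨m, h.symm⟩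
      simp [mod_mem_schurResidues_iff ht, hn, this]
  rw [expand_prodOn, ← prodOn_union hdisj]
  exact congrArg prodOn hunion

theorem schurSeries_mul {t : ℕ} (ht : Odd t) :
    schurSeries t * evalNegHom phi * V[2] (expand t ht.pos.ne' (evalNegHom phi)) =
      V[2] (evalNegHom phi) * expand t ht.pos.ne' (evalNegHom phi) := by
  have hcomm : expand t ht.pos.ne' (V[2] euler) = V[2] (expand t ht.pos.ne' euler) := by
    simp only [← expand_mul, mul_comm]
  have hd := oddProd_eq_schurProd_mul ht
  have hd₂ := congrArg (V[2]) hd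
  have hE := congrArg (V[2]) euler_eq_oddProd_mul
  have hEt := congrArg (fun f => V[2] (expand t ht.pos.ne' f)) euler_eq_oddProd_mul
  simp only [map_mul] at hd₂ hE hEt
  simp only [evalNegHom_phi_eq, map_mul, map_pow, hcomm] at hEt ⊢
  set W := V[2] (V[2] (expand t ht.pos.ne' euler))
  set T₂ := V[2] (expand t ht.pos.ne' oddProd)
  set T := expand t ht.pos.ne' oddProd
  linear_combination T ^ 2 * V[2] euler * T₂ ^ 2 * W * schurSeries_mul_schurProd_sq t +
    schurSeries t * (oddProd + schurProd t * T) * V[2] euler * T₂ ^ 2 * W * hd -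
    T ^ 2 * V[2] oddProd * V[2] (V[2] euler) * T₂ * W * hd₂ +
    V[2] (schurProd t) * T ^ 2 * T₂ ^ 2 * W * hE -
    V[2] oddProd ^ 2 * V[2] (V[2] euler) * T ^ 2 * hEt

end GeneratingFunction

section Congruences

theorem natCast_dvd_iff {c : ℕ} {f : ℤ⟦X⟧} : (c : ℤ⟦X⟧) ∣ f ↔ ∀ n, (c : ℤ) ∣ coeff n f := by
  rw [← map_natCast (C (R := ℤ))]
  refine ⟨?_, fun h => ?_⟩
  · rintro ⟨g, rfl⟩ n
    exact ⟨coeff n g, coeff_C_mul n g c⟩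
  · choose g hg using h
    refine ⟨PowerSeries.mk g, ?_⟩
    ext n
    rw [coeff_C_mul, coeff_mk]
    exact hg n

theorem natCast_dvd_pow_sub_expand {p : ℕ} (hp : p.Prime) (f : ℤ⟦X⟧) :
    (p : ℤ⟦X⟧) ∣ f ^ p - expand p hp.ne_zero f := by
  have := Fact.mk hp
  let red := PowerSeries.map (Int.castRingHom (ZMod p))
  have hfrob : expand p hp.ne_zero (red f) = red f ^ p := by
    have h := MvPowerSeries.map_frobenius_expand p hp.ne_zero (f := red f)
    rwa [ZMod.frobenius_zmod, MvPowerSeries.map_id] at h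
  rw [← map_expand, ← map_pow] at hfrob
  refine natCast_dvd_iff.2 fun n => ?_
  rw [map_sub, ← ZMod.intCast_eq_intCast_iff_dvd_sub]
  simpa only [red, coeff_map, eq_intCast] using congrArg (coeff n) hfrob

theorem two_dvd_sq_sub_expand (f : ℤ⟦X⟧) : 2 ∣ f ^ 2 - V[2] f :=
  natCast_dvd_pow_sub_expand Nat.prime_two f

theorem two_dvd_evalNegHom_phi_sub_one : 2 ∣ evalNegHom phi - 1 := by
  have hunit : IsUnit (V[2] euler) := by
    rw [isUnit_iff_constantCoeff, constantCoeff_expand, constantCoeff_euler]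
    exact isUnit_one
  rw [← hunit.dvd_mul_right, sub_one_mul, evalNegHom_phi_mul_euler]
  exact two_dvd_sq_sub_expand euler

theorem four_dvd_evalNegHom_phi_sq_sub_one : 4 ∣ evalNegHom phi ^ 2 - 1 := by
  have h := dvd_sub_pow_of_dvd_sub (p := 2) two_dvd_evalNegHom_phi_sub_one 1
  norm_num at h
  exact h

theorem four_dvd_phi_mul_euler_sq_sub : 4 ∣ phi * euler ^ 2 - V[2] euler := by
  have h := map_dvd (V[2]) four_dvd_evalNegHom_phi_sq_sub_one
  rw [map_sub, map_pow, map_one, map_ofNat, ← phi_mul_evalNegHom_phi] at h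
  convert h.mul_right (V[2] euler) using 1
  linear_combination -phi * evalNegHom_phi_mul_euler

theorem psi_mul_euler : psi * euler = V[2] euler ^ 2 := by
  linear_combination psi * euler_eq_oddProd_mul + V[2] euler * oddProd_mul_psi

theorem two_dvd_psi_mul_euler_sq_sub : 2 ∣ V[2] psi * euler ^ 2 - V[8] euler := by
  have hψ := congrArg (V[2]) psi_mul_euler
  have h4 := map_dvd (V[4]) (two_dvd_sq_sub_expand euler)
  simp only [map_sub, map_mul, map_pow, map_ofNat, ← expand_mul, Nat.reduceMul] at hψ h4
  convert (two_dvd_evalNegHom_phi_sub_one.mul_right (V[4] euler ^ 2)).add h4 using 1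
  linear_combination evalNegHom phi * hψ - V[2] psi * evalNegHom_phi_mul_euler

end Congruences

section ThreeSchur

theorem schurSeries_three_mul :
    schurSeries 3 * V[2] (evalNegHom phi * V[3] (evalNegHom phi)) =
      phi * V[3] (evalNegHom phi) := by
  have h := schurSeries_mul (show Odd 3 by decide)
  have hne : V[2] (evalNegHom phi) ≠ 0 :=
    ne_zero_of_constantCoeff_eq_one (by simp [constantCoeff_evalNegHom, constantCoeff_phi])
  apply mul_left_cancel₀ hne
  rw [map_mul]
  linear_combination phi * h -
    schurSeries 3 * V[2] (V[3] (evalNegHom phi)) * phi_mul_evalNegHom_phi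

theorem dissect_two_one_schurSeries_mul :
    dissect 2 1 (schurSeries 3) * V[2] (evalNegHom phi * V[3] (evalNegHom phi)) =
      2 * (psi * V[3] psi) := by
  have h := congrArg (dissect 2 1) schurSeries_three_mul
  rw [mul_comm, dissect_expand_mul two_ne_zero one_lt_two,
    dissect_two_one_phi_mul_evalNegHom_phi] at h
  have hψ := evalNegHom_psi_mul
  have hψ₃ := congrArg (V[3]) hψ
  have hne : evalNegHom phi * V[3] (evalNegHom phi) ≠ 0 :=
    ne_zero_of_constantCoeff_eq_one (by simp [constantCoeff_evalNegHom, constantCoeff_phi])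
  apply mul_left_cancel₀ hne
  simp only [map_mul, ← expand_mul, Nat.reduceMul] at h hψ₃ ⊢
  linear_combination V[2] (evalNegHom phi) * V[6] (evalNegHom phi) * h +
    2 * V[3] (evalNegHom psi) * V[6] (evalNegHom phi) * hψ +
    2 * psi * evalNegHom phi * hψ₃

theorem dissect_four_three_schurSeries_mul :
    dissect 4 3 (schurSeries 3) * (evalNegHom phi * V[3] (evalNegHom phi)) =
      2 * (phi * V[6] psi) := by
  have h := congrArg (dissect 2 1) dissect_two_one_schurSeries_mul
  have htwo := dissect_natCast_mul 2 1 2 (psi * V[3] psi)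
  rw [Nat.cast_ofNat] at htwo
  rw [mul_comm, dissect_expand_mul two_ne_zero one_lt_two, dissect_dissect, htwo,
    dissect_two_one_psi_mul_psi] at h
  linear_combination h

theorem dissect_twelve_seven_schurSeries_mul :
    dissect 12 7 (schurSeries 3) *
        (evalNegHom phi * (V[3] (evalNegHom phi) ^ 3 - 8 * X * evalNegHom omega ^ 3)) =
      8 * (V[2] psi * V[3] (evalNegHom phi) * V[4] (euler ^ 2)) := by
  set H := dissect 4 3 (schurSeries 3) with hH
  set a := V[3] (evalNegHom phi) with ha
  set b := V[3] phi with hb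
  set v := evalNegHom omega
  have h := dissect_four_three_schurSeries_mul
  have h₁ := phi_three_dissection
  have h₂ := evalNegHom_phi_three_dissection
  rw [show V[9] phi = V[3] b by rw [hb, ← expand_mul]] at h₁
  rw [show V[9] (evalNegHom phi) = V[3] a by rw [ha, ← expand_mul]] at h₂
  rw [show V[6] psi = V[3] (V[2] psi) by rw [← expand_mul]] at h
  -- `A³ - B³ = (A - B)(A² + AB + B²)` turns the factor `φ(-q) = A - B` into a series in `q³`.
  have key : V[3] (evalNegHom phi * (a ^ 3 - 8 * X * v ^ 3)) * H =
      V[3] (2 * V[2] psi * (a ^ 2 * b + 8 * X * v ^ 2 * omega)) +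
      X * V[3] (4 * V[2] psi * a * (b * v + a * omega)) +
      X ^ 2 * V[3] (8 * V[2] psi * v * (b * v + a * omega)) := by
    simp only [map_mul, map_add, map_sub, map_pow, map_ofNat, expand_X]
    rw [← ha]
    set S := V[3] a ^ 2 + 2 * X * V[3] a * V[3] v + 4 * X ^ 2 * V[3] v ^ 2
    linear_combination S * h - a * H * S * h₂ + 2 * S * V[3] (V[2] psi) * h₁
  have h₃ := congrArg (dissect 3 1) key
  rw [dissect_three_one_add, dissect_expand_mul _ (by decide), hH, dissect_dissect] at h₃
  linear_combination h₃ + 4 * V[2] psi * a * phi_mul_evalNegHom_omega_add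

theorem four_dvd_dissection_factor_sub :
    4 ∣ V[3] (evalNegHom phi) ^ 2 * evalNegHom phi * V[4] (euler ^ 2) -
      (V[8] euler - 2 * (X * V[32] euler)) := by
  have ha := map_dvd (V[3]) four_dvd_evalNegHom_phi_sq_sub_one
  have hφ := map_dvd (V[4]) four_dvd_phi_mul_euler_sq_sub
  have hψ := map_dvd (V[4]) two_dvd_psi_mul_euler_sq_sub
  simp only [map_sub, map_mul, map_pow, map_one, map_ofNat, ← expand_mul, Nat.reduceMul] at *
  obtain ⟨u, hu⟩ := ha
  obtain ⟨v, hv⟩ := hφ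
  obtain ⟨w, hw⟩ := hψ
  refine ⟨u * evalNegHom phi * V[4] euler ^ 2 + v - X * w, ?_⟩
  linear_combination evalNegHom phi * V[4] euler ^ 2 * hu + hv - 2 * X * hw +
    V[4] euler ^ 2 * evalNegHom_phi_two_dissection

theorem thirtyTwo_dvd_dissect_twelve_seven_schurSeries_sub :
    32 ∣ dissect 12 7 (schurSeries 3) -
      8 * (V[2] psi * (V[8] euler - 2 * (X * V[32] euler))) := by
  have h := dissect_twelve_seven_schurSeries_mul
  obtain ⟨s, hs⟩ := four_dvd_evalNegHom_phi_sq_sub_one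
  obtain ⟨t, ht⟩ := map_dvd (V[3]) four_dvd_evalNegHom_phi_sq_sub_one
  obtain ⟨z, hz⟩ := four_dvd_dissection_factor_sub
  simp only [map_sub, map_pow, map_one, map_ofNat] at ht h hz
  set L := dissect 12 7 (schurSeries 3)
  set a := V[3] (evalNegHom phi)
  set Z := V[2] psi * (a ^ 2 * evalNegHom phi * V[4] euler ^ 2)
  obtain ⟨v, hv⟩ : ∃ v, L * (1 + 4 * v) = 8 * Z := by
    refine ⟨s + (1 + 4 * s) * (2 * t + 4 * t ^ 2) -
      2 * X * evalNegHom phi ^ 2 * a * evalNegHom omega ^ 3, ?_⟩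
    linear_combination evalNegHom phi * a * h - L * a ^ 4 * hs -
      L * (1 + 4 * s) * (a ^ 2 + 1 + 4 * t) * ht
  refine ⟨V[2] psi * z - v * Z + 4 * v ^ 2 * Z - 2 * v ^ 3 * L, ?_⟩
  linear_combination (1 - 4 * v + 16 * v ^ 2) * hv + 8 * V[2] psi * hz

theorem two_dvd_schurSeries_sub_one (t : ℕ) : 2 ∣ schurSeries t - 1 := by
  have hunit : IsUnit (schurProd t ^ 2) := by
    rw [isUnit_iff_constantCoeff, map_pow, constantCoeff_prodOn (by simp [schurResidues])]
    simp
  rw [← hunit.dvd_mul_right, sub_one_mul, schurSeries_mul_schurProd_sq, dvd_sub_comm]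
  exact two_dvd_sq_sub_expand (schurProd t)

theorem thirtyTwo_dvd_schurSeries_pow_sub (t m : ℕ) :
    32 ∣ schurSeries t ^ (16 * m + 1) - schurSeries t := by
  have h16 := dvd_sub_pow_of_dvd_sub (p := 2) (two_dvd_schurSeries_sub_one t) 4
  norm_num at h16
  have hm := h16.trans (sub_one_dvd_pow_sub_one (schurSeries t ^ 16) m)
  convert hm.mul_left (schurSeries t) using 1
  ring

theorem coeff_expand_psi_mul_expand_euler_eq_zero {l n : ℕ} [NeZero l]
    (h : ∀ x y : ℤ, 3 * x ^ 2 + (l * y) ^ 2 ≠ 12 * n + 3 + l ^ 2) :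
    coeff n (V[2] psi * V[2 * l ^ 2] euler) = 0 := by
  have hl : (0 : ℤ) < (2 * l ^ 2 : ℕ) := by exact_mod_cast NeZero.pos (2 * l ^ 2)
  rw [psi, euler_eq_series, expand_series, expand_series, series_mul_series
    (isExponent_two_mul_sq_add.const_mul (by decide)) (isExponent_pentagonal.const_mul hl)]
  refine coeff_series_eq_zero _ fun ⟨i, j⟩ hij => h (4 * i + 1) (6 * j - 1) ?_
  push_cast at hij
  linear_combination 12 * hij - 12 * (l : ℤ) ^ 2 * two_mul_natCast_pentagonal j

theorem thirtyTwo_dvd_coeff_schurSeries_pow {N : ℕ} (hN : N ≡ 7 [MOD 12])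
    (hrep : ∀ x y : ℤ, 3 * x ^ 2 + y ^ 2 ≠ N) (m : ℕ) :
    32 ∣ coeff N (schurSeries 3 ^ (16 * m + 1)) := by
  obtain ⟨n, rfl⟩ : ∃ n, N = 12 * n + 7 := ⟨N / 12, by unfold Nat.ModEq at hN; omega⟩
  have h8 : coeff n (V[2] psi * V[8] euler) = 0 :=
    coeff_expand_psi_mul_expand_euler_eq_zero (l := 2) fun x y h =>
      hrep x (2 * y) (by push_cast at h ⊢; linarith)
  have h32 : coeff n (X * (V[2] psi * V[32] euler)) = 0 := by
    cases n with
    | zero => exact coeff_zero_X_mul _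
    | succ n =>
      rw [coeff_succ_X_mul]
      exact coeff_expand_psi_mul_expand_euler_eq_zero (l := 4) fun x y h =>
        hrep x (4 * y) (by push_cast at h ⊢; linarith)
  have hpow := natCast_dvd_iff (c := 32).1 (thirtyTwo_dvd_schurSeries_pow_sub 3 m) (12 * n + 7)
  have hdis := natCast_dvd_iff (c := 32).1
    thirtyTwo_dvd_dissect_twelve_seven_schurSeries_sub n
  have hmain : coeff n (8 * (V[2] psi * (V[8] euler - 2 * (X * V[32] euler)))) = 0 := by
    rw [show 8 * (V[2] psi * (V[8] euler - 2 * (X * V[32] euler))) =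
      C 8 * (V[2] psi * V[8] euler) - C 16 * (X * (V[2] psi * V[32] euler)) by
        simp only [map_ofNat]; ring, map_sub, coeff_C_mul, coeff_C_mul, h8, h32]
    ring
  rw [map_sub, hmain, sub_zero, coeff_dissect] at hdis
  rw [map_sub] at hpow
  exact (dvd_sub_left hdis).1 hpow

end ThreeSchur

section QuadraticForm

variable {p : ℕ}

theorem sq_sub_mul_sq_ne_of_legendreSym_eq_neg_one [Fact p.Prime] {a : ℤ}
    (ha : legendreSym p a = -1) (k : ℕ) {c : ℤ} (hc : ¬ (p : ℤ) ∣ c) (x y : ℤ) :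
    x ^ 2 - a * y ^ 2 ≠ p ^ (2 * k + 1) * c := by
  have hp : (p : ℤ) ≠ 0 := by exact_mod_cast NeZero.ne p
  induction k generalizing x y with
  | zero =>
    intro h
    obtain ⟨⟨u, rfl⟩, v, rfl⟩ := legendreSym.prime_dvd_of_eq_neg_one ha
      (x := x) (y := y) ⟨c, by rw [h]; ring⟩
    refine hc ⟨u ^ 2 - a * v ^ 2, mul_left_cancel₀ hp ?_⟩
    linear_combination -h
  | succ k ih =>
    intro h
    obtain ⟨⟨u, rfl⟩, v, rfl⟩ := legendreSym.prime_dvd_of_eq_neg_one ha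
      (x := x) (y := y) ⟨p ^ (2 * k + 2) * c, by rw [h]; ring⟩
    refine ih u v (mul_left_cancel₀ (pow_ne_zero 2 hp) ?_)
    linear_combination h

theorem legendreSym_neg_three [Fact p.Prime] (hp : p ≡ 5 [MOD 6]) :
    legendreSym p (-3) = -1 := by
  have hp_mod : p % 6 = 5 := hp
  have hp2 : p ≠ 2 := by omega
  have hneg : legendreSym p (-1) = (-1) ^ (p / 2) := by
    rw [legendreSym.at_neg_one hp2, ZMod.χ₄_eq_neg_one_pow (by omega)]
  have hthree : legendreSym p 3 = (-1) ^ (p / 2) * legendreSym 3 p := by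
    simpa using legendreSym.quadratic_reciprocity' (p := 3) (q := p) (by decide) hp2
  have hp3 : legendreSym 3 p = -1 := by
    rw [legendreSym.mod, show (p : ℤ) % (3 : ℕ) = 2 by omega]
    decide
  rw [show (-3 : ℤ) = -1 * 3 by norm_num, legendreSym.mul, hneg, hthree, hp3]
  rw [← mul_assoc, ← mul_pow]
  norm_num

theorem progression_modEq (hp : p ≡ 5 [MOD 6]) (α n i r : ℕ) :
    24 * p ^ (2 * α + 2) * n + (24 * i + r * p) * p ^ (2 * α + 1) ≡ r [MOD 12] := by
  have hsq : p ^ 2 ≡ 1 [MOD 12] := by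
    have : p % 12 = 5 ∨ p % 12 = 11 := by unfold Nat.ModEq at hp; omega
    rcases this with h | h <;> simp [Nat.ModEq, Nat.pow_mod, h]
  calc 24 * p ^ (2 * α + 2) * n + (24 * i + r * p) * p ^ (2 * α + 1)
    _ = r * (p ^ 2) ^ (α + 1) + 12 * (2 * (p ^ (2 * α + 2) * n + i * p ^ (2 * α + 1))) := by ring
    _ ≡ r * 1 ^ (α + 1) + 0 [MOD 12] :=
      ((hsq.pow _).mul_left r).add (Nat.modEq_zero_iff_dvd.2 (dvd_mul_right _ _))
    _ = r := by simp

theorem three_mul_sq_add_sq_ne_progression (hp : p.Prime) (hp5 : p ≡ 5 [MOD 6]) (α n : ℕ) {i : ℕ}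
    (hi : ¬ p ∣ i) (r : ℕ) (x y : ℤ) :
    3 * x ^ 2 + y ^ 2 ≠
      (24 * p ^ (2 * α + 2) * n + (24 * i + r * p) * p ^ (2 * α + 1) : ℕ) := by
  have := Fact.mk hp
  have hp24 : p.Coprime 24 := by
    rw [show 24 = 2 ^ 3 * 3 by norm_num, Nat.coprime_mul_iff_right]
    have hmod : p % 6 = 5 := hp5
    exact ⟨((Nat.coprime_primes hp Nat.prime_two).2 (by omega)).pow_right 3,
      (Nat.coprime_primes hp Nat.prime_three).2 (by omega)⟩
  have hc : ¬ (p : ℤ) ∣ (p * (24 * n + r) + 24 * i : ℕ) := by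
    rw [Int.natCast_dvd_natCast, Nat.dvd_add_right (dvd_mul_right _ _), hp24.dvd_mul_left]
    exact hi
  intro h
  apply sq_sub_mul_sq_ne_of_legendreSym_eq_neg_one (legendreSym_neg_three hp5) α hc y x
  push_cast at h ⊢
  linear_combination h

end QuadraticForm

end ThetaSeries

theorem theorem4p6_general {N : ℕ} (hN : N ≡ 7 [MOD 12])
    (hrep : ∀ x y : ℤ, 3 * x ^ 2 + y ^ 2 ≠ N) (m : ℕ) :
    schurOverpartitionTupleCount 3 (16 * m + 1) N ≡ 0 [MOD 32] := by
  have h := ThetaSeries.thirtyTwo_dvd_coeff_schurSeries_pow hN hrep m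
  rw [ThetaSeries.coeff_schurSeries_pow] at h
  exact Nat.modEq_zero_iff_dvd.2 (by exact_mod_cast h)

theorem theorem4p6 (p : ℕ) (hp : p.Prime) (hp5 : p ≡ 5 [MOD 6]) (α n i : ℕ)
    (hi1 : 1 ≤ i) (hip : i ≤ p - 1) :
    schurOverpartitionCount 3
        (24 * p ^ (2 * α + 2) * n + (24 * i + 7 * p) * p ^ (2 * α + 1)) ≡ 0 [MOD 32] ∧
    ∀ m : ℕ,
      schurOverpartitionTupleCount 3 (16 * m + 1)
        (24 * p ^ (2 * α + 2) * n + (24 * i + 19 * p) * p ^ (2 * α + 1)) ≡ 0 [MOD 32] := by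
  have h (r : ℕ) (hr : r ≡ 7 [MOD 12]) := theorem4p6_general
    ((ThetaSeries.progression_modEq hp5 α n i r).trans hr)
    (ThetaSeries.three_mul_sq_add_sq_ne_progression hp hp5 α n
      (Nat.not_dvd_of_pos_of_lt hi1 (by omega)) r)
  exact ⟨by simpa only [← ThetaSeries.schurOverpartitionTupleCount_one] using h 7 rfl 0, h 19 rfl⟩
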